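/- Let $\Phi\in\mathcal S(\mathbb R)$ be a complex-valued Schwartz function with $\int_{\mathbb R}\Phi(x)\,dx\neq 0$, and put $\Phi_t(x)=t^{-1}\Phi(x/t)$ for $t>0$. Let $H^1(\mathbb R)$ be the space of all (complex-valued) $f\in L^1(\mathbb R)$ such that $$\|f\|_{H^1(\mathbb R)}:=\|M_\Phi f\|_{L^1(\mathbb R)}<\infty,\qquad M_\Phi f(x):=\sup_{t>0}|f*\Phi_t(x)| .$$ Let $\varphi$ be a nonnegative function in $L^1(0,\infty)$. Then the Hausdorff operator $$\mathcal H_\varphi f(x)=\int_0^\infty f\left(\frac xt\right)\frac{\varphi(t)}{t}\,dt$$ is well defined on $H^1(\mathbb R)$ (for every $f\in H^1(\mathbb R)$ the integral converges absolutely for almost every $x$, and modifying $f$ on a null set changes $\mathcal H_\varphi f$ only on a null set), it maps $H^1(\mathbb R)$ into itself, and $$\|\mathcal H_\varphi\|_{H^1(\mathbb R)\to H^1(\mathbb R)}:=\sup\{\|\mathcal H_\varphi f\|_{H^1(\mathbb R)} : f\in H^1(\mathbb R),\ \|f\|_{H^1(\mathbb R)}\le 1\}=\int_0^\infty\varphi(t)\,dt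 .$$ In particular, the operator norm does not depend on the choice of $\Phi$. -/

import Mathlib

open MeasureTheory Set
open scoped ENNReal SchwartzMap Convolution

namespace RealHardy

/-- The Hausdorff operator `f ↦ (x ↦ ∫₀^∞ f(x/t) φ(t)/t dt)` generated by `φ`. -/
noncomputable def hausdorff (φ : ℝ → ℝ) (f : ℝ → ℂ) (x : ℝ) : ℂ :=
  ∫ t in Ioi (0 : ℝ), f (x / t) * ((φ t / t : ℝ) : ℂ)

/-- The dilation `Φ_t(x) = t⁻¹ Φ(x/t)`. -/
noncomputable def dilate (Φ : ℝ → ℂ) (t : ℝ) (x : ℝ) : ℂ :=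
  ((t⁻¹ : ℝ) : ℂ) * Φ (x / t)

/-- The smooth maximal function `M_Φ f(x) = sup_{t > 0} |f * Φ_t(x)|`, with values in `[0, ∞]`. -/
noncomputable def maximalFunction (Φ : 𝓢(ℝ, ℂ)) (f : ℝ → ℂ) (x : ℝ) : ℝ≥0∞ :=
  ⨆ t : ℝ, ⨆ _ : 0 < t, ‖(f ⋆[ContinuousLinearMap.mul ℂ ℂ, volume] dilate Φ t) x‖ₑ

/-- The Hardy norm `‖M_Φ f‖_{L¹(ℝ)}`, with values in `[0, ∞]`. -/
noncomputable def hardyNorm (Φ : 𝓢(ℝ, ℂ)) (f : ℝ → ℂ) : ℝ≥0∞ :=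
  ∫⁻ x, maximalFunction Φ f x

/-- Membership in `H¹(ℝ)`: `f ∈ L¹(ℝ)` and `‖M_Φ f‖_{L¹(ℝ)} < ∞`. -/
def MemH1 (Φ : 𝓢(ℝ, ℂ)) (f : ℝ → ℂ) : Prop :=
  Integrable f ∧ hardyNorm Φ f < ∞

/-- The operator norm of `T` on `H¹(ℝ)` with respect to `‖M_Φ f‖_{L¹(ℝ)}`:
the supremum of `‖T f‖` over the closed unit ball of `H¹(ℝ)`, with values in `[0, ∞]`. -/
noncomputable def opNormH1 (Φ : 𝓢(ℝ, ℂ)) (T : (ℝ → ℂ) → ℝ → ℂ) : ℝ≥0∞ :=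
  ⨆ f : ℝ → ℂ, ⨆ _ : MemH1 Φ f ∧ hardyNorm Φ f ≤ 1, hardyNorm Φ (T f)

end RealHardy

namespace RealHardy

open Filter Topology

/-! Write `D_t f(x) = t⁻¹ f(x/t)`, so that the operator is `∫ φ(t) D_t f dt`. Each `D_t` preserves
the Hardy norm, because the supremum over scales absorbs a dilation. Minkowski's inequality
(`hardyNorm_integral_le`) then gives boundedness and the upper bound `∫ |φ|`.

The lower bound needs functions that are almost invariant under all `D_t`. Averaging an `f` over
dilations, `f_N = ∫_1^N D_s f ds/s`, does this: `ds/s` is invariant under scaling, so `D_t f_N -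
f_N` involves only two end pieces of logarithmic length `|log t|`, and its norm is at most `2 |log
t| ‖f‖`, uniformly in `N` (`hardyNorm_logAverage_dilate_sub_le`). For the step function `haar`,
which lies in `H¹` by cancellation (`memH1_haar`), the average equals `1/x - 1/N` on `(1, N)`. Since
`M_Φ g ≥ |g| |∫ Φ|` at continuity points of a bounded `g`, the norm of `f_N` is at least `(log N -
1) |∫ Φ|` and tends to infinity.

Hence the relative defect `‖D_t f_N - f_N‖ / ‖f_N‖` tends to 0 for each `t` and never exceeds 2. By
dominated convergence against `|φ|`, the operator acts on `f_N` as multiplication by `∫ φ` up to a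
relative error tending to 0, so its norm is at least `|∫ φ|`
(`enorm_integral_le_opNormH1_hausdorff`). For `φ ≥ 0` the two bounds coincide. -/

/-! ### The smooth maximal function: measurability and seminorm properties of the Hardy norm. -/

theorem convolution_dilate_apply (f Φ : ℝ → ℂ) (s x : ℝ) :
    (f ⋆[ContinuousLinearMap.mul ℂ ℂ, volume] dilate Φ s) x =
      ∫ u, f u * (((s⁻¹ : ℝ) : ℂ) * Φ ((x - u) / s)) := rfl

theorem norm_dilate_le (Φ : 𝓢(ℝ, ℂ)) (s x : ℝ) :
    ‖((s⁻¹ : ℝ) : ℂ) * Φ (x / s)‖ ≤ |s⁻¹| * SchwartzMap.seminorm ℂ 0 0 Φ := by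
  rw [norm_mul, Complex.norm_real, Real.norm_eq_abs]
  gcongr
  exact SchwartzMap.norm_le_seminorm ℂ Φ _

theorem integrable_mul_dilate (Φ : 𝓢(ℝ, ℂ)) {f : ℝ → ℂ} (hf : Integrable f) (s x : ℝ) :
    Integrable fun u => f u * (((s⁻¹ : ℝ) : ℂ) * Φ ((x - u) / s)) := by
  refine hf.mul_bdd (c := |s⁻¹| * SchwartzMap.seminorm ℂ 0 0 Φ) ?_
    (ae_of_all _ fun u => norm_dilate_le Φ s _)
  have := Φ.continuous
  exact Continuous.aestronglyMeasurable (by fun_prop)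

/-- Continuity in the scale reduces the uncountable supremum to a countable one, which is what makes
the maximal function measurable. Domination holds because `r > s/2` near `s`. -/
theorem continuousAt_convolution_dilate (Φ : 𝓢(ℝ, ℂ)) {f : ℝ → ℂ} (hf : Integrable f) (x : ℝ)
    {s : ℝ} (hs : 0 < s) :
    ContinuousAt (fun r => (f ⋆[ContinuousLinearMap.mul ℂ ℂ, volume] dilate Φ r) x) s := by
  simp only [convolution_dilate_apply]
  refine continuousAt_of_dominated
    (bound := fun u => ‖f u‖ * ((s / 2)⁻¹ * SchwartzMap.seminorm ℂ 0 0 Φ))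
    (.of_forall fun r => (integrable_mul_dilate Φ hf r x).aestronglyMeasurable) ?_
    (hf.norm.mul_const _) (ae_of_all _ fun u => ?_)
  · filter_upwards [lt_mem_nhds (half_lt_self hs)] with r hr
    refine ae_of_all _ fun u => ?_
    rw [norm_mul]
    gcongr
    refine (norm_dilate_le Φ r _).trans ?_
    have : 0 < r := (half_pos hs).trans hr
    rw [abs_of_pos (inv_pos.2 this)]
    gcongr
  · have h := Φ.continuous
    have h1 : ContinuousAt (fun r : ℝ => r⁻¹) s := continuousAt_inv₀ hs.ne'
    have h2 : ContinuousAt (fun r : ℝ => (x - u) / r) s :=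
      continuousAt_const.div continuousAt_id hs.ne'
    exact continuousAt_const.mul
      ((Complex.continuous_ofReal.continuousAt.comp h1).mul (h.continuousAt.comp h2))

/-- For integrable `f` the supremum may be taken over positive rational scales. -/
theorem maximalFunction_eq_iSup_rat (Φ : 𝓢(ℝ, ℂ)) {f : ℝ → ℂ} (hf : Integrable f) (x : ℝ) :
    maximalFunction Φ f x = ⨆ q : {q : ℚ // 0 < q},
      ‖∫ u, f u * ((((q.1 : ℝ)⁻¹ : ℝ) : ℂ) * Φ ((x - u) / (q.1 : ℝ)))‖ₑ := by
  apply le_antisymm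
  · refine iSup₂_le fun s hs => ?_
    have hc := (continuousAt_convolution_dilate Φ hf x hs).enorm
    refine le_of_forall_lt fun b hb => ?_
    have hev := hc.eventually (lt_mem_nhds hb)
    obtain ⟨l, u, hlu, hsub⟩ := mem_nhds_iff_exists_Ioo_subset.1 (hev.and (lt_mem_nhds hs))
    obtain ⟨q, hq⟩ := exists_rat_btwn (hlu.1.trans hlu.2)
    have hq' := hsub ⟨hq.1, hq.2⟩
    refine hq'.1.trans_le ?_
    exact le_iSup (fun q : {q : ℚ // 0 < q} =>
      ‖∫ u, f u * ((((q.1 : ℝ)⁻¹ : ℝ) : ℂ) * Φ ((x - u) / (q.1 : ℝ)))‖ₑ)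
      ⟨q, by exact_mod_cast hq'.2⟩
  · refine iSup_le fun q => ?_
    exact le_iSup₂ (f := fun (t : ℝ) (_ : 0 < t) =>
      ‖(f ⋆[ContinuousLinearMap.mul ℂ ℂ, volume] dilate Φ t) x‖ₑ) (q.1 : ℝ)
      (by exact_mod_cast q.2)

theorem maximalFunction_congr_ae (Φ : 𝓢(ℝ, ℂ)) {f g : ℝ → ℂ} (h : f =ᵐ[volume] g) :
    maximalFunction Φ f = maximalFunction Φ g := by
  funext x
  unfold maximalFunction
  congr! 4 with t ht
  simp only [convolution_dilate_apply]
  refine integral_congr_ae ?_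
  filter_upwards [h] with u hu
  rw [hu]

theorem hardyNorm_congr_ae (Φ : 𝓢(ℝ, ℂ)) {f g : ℝ → ℂ} (h : f =ᵐ[volume] g) :
    hardyNorm Φ f = hardyNorm Φ g := by
  simp only [hardyNorm, maximalFunction_congr_ae Φ h]

theorem maximalFunction_const_mul (Φ : 𝓢(ℝ, ℂ)) (c : ℂ) (f : ℝ → ℂ) (x : ℝ) :
    maximalFunction Φ (fun x => c * f x) x = ‖c‖ₑ * maximalFunction Φ f x := by
  simp only [maximalFunction, ENNReal.mul_iSup, convolution_dilate_apply, mul_assoc,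
    integral_const_mul, enorm_mul]

theorem hardyNorm_const_mul (Φ : 𝓢(ℝ, ℂ)) (c : ℂ) (f : ℝ → ℂ) :
    hardyNorm Φ (fun x => c * f x) = ‖c‖ₑ * hardyNorm Φ f := by
  simp only [hardyNorm, maximalFunction_const_mul]
  exact lintegral_const_mul' _ _ enorm_ne_top

theorem maximalFunction_add_le (Φ : 𝓢(ℝ, ℂ)) {f g : ℝ → ℂ} (hf : Integrable f)
    (hg : Integrable g) (x : ℝ) :
    maximalFunction Φ (fun x => f x + g x) x ≤ maximalFunction Φ f x + maximalFunction Φ g x := by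
  refine iSup₂_le fun t ht => ?_
  have : (((fun x => f x + g x) ⋆[ContinuousLinearMap.mul ℂ ℂ, volume] dilate Φ t) x) =
      ((f ⋆[ContinuousLinearMap.mul ℂ ℂ, volume] dilate Φ t) x) +
      ((g ⋆[ContinuousLinearMap.mul ℂ ℂ, volume] dilate Φ t) x) := by
    simp only [convolution_dilate_apply, add_mul]
    exact integral_add (integrable_mul_dilate Φ hf t x) (integrable_mul_dilate Φ hg t x)
  rw [this]
  refine (enorm_add_le _ _).trans (add_le_add ?_ ?_)
  · exact le_iSup₂ (f := fun (t : ℝ) (_ : 0 < t) =>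
      ‖(f ⋆[ContinuousLinearMap.mul ℂ ℂ, volume] dilate Φ t) x‖ₑ) t ht
  · exact le_iSup₂ (f := fun (t : ℝ) (_ : 0 < t) =>
      ‖(g ⋆[ContinuousLinearMap.mul ℂ ℂ, volume] dilate Φ t) x‖ₑ) t ht

/-- The parameter space `α` is there for Tonelli in Minkowski's inequality, where joint
measurability in `(t, x)` is needed; a single function is the case `α = Unit`. -/
theorem measurable_integral_mul_dilate {α : Type*} [MeasurableSpace α] (Φ : 𝓢(ℝ, ℂ))
    {F : α → ℝ → ℂ} (hF : StronglyMeasurable (Function.uncurry F)) (s : ℝ) :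
    Measurable fun p : α × ℝ => ∫ u, F p.1 u * (((s⁻¹ : ℝ) : ℂ) * Φ ((p.2 - u) / s)) := by
  have h1 : StronglyMeasurable fun p : (α × ℝ) × ℝ => F p.1.1 p.2 :=
    hF.comp_measurable (g := fun p : (α × ℝ) × ℝ => (p.1.1, p.2)) (by fun_prop)
  have h2 : StronglyMeasurable fun p : (α × ℝ) × ℝ =>
      (((s⁻¹ : ℝ) : ℂ) * Φ ((p.1.2 - p.2) / s)) := by
    have h := Φ.continuous
    have : Continuous fun x : ℝ => (((s⁻¹ : ℝ) : ℂ) * Φ (x / s)) := by fun_prop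
    exact this.stronglyMeasurable.comp_measurable
      (g := fun p : (α × ℝ) × ℝ => p.1.2 - p.2) (by fun_prop)
  exact (h1.mul h2).integral_prod_right'.measurable

theorem measurable_maximalFunction (Φ : 𝓢(ℝ, ℂ)) {f : ℝ → ℂ} (hf : Integrable f) :
    Measurable (maximalFunction Φ f) := by
  obtain ⟨g, hg, hfg⟩ := hf.1
  rw [maximalFunction_congr_ae Φ hfg, funext (maximalFunction_eq_iSup_rat Φ (hf.congr hfg))]
  have h := fun s => measurable_integral_mul_dilate Φ (F := fun _ : Unit => g)
    (hg.comp_measurable measurable_snd) s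
  exact Measurable.iSup fun q => ((h q.1).comp (measurable_prodMk_left (x := ()))).enorm

theorem hardyNorm_add_le (Φ : 𝓢(ℝ, ℂ)) {f g : ℝ → ℂ} (hf : Integrable f) (hg : Integrable g) :
    hardyNorm Φ (fun x => f x + g x) ≤ hardyNorm Φ f + hardyNorm Φ g := by
  simp only [hardyNorm]
  rw [← lintegral_add_left (measurable_maximalFunction Φ hf)]
  exact lintegral_mono (maximalFunction_add_le Φ hf hg)

theorem hardyNorm_sub_le (Φ : 𝓢(ℝ, ℂ)) {f g : ℝ → ℂ} (hf : Integrable f) (hg : Integrable g) :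
    hardyNorm Φ (fun x => f x - g x) ≤ hardyNorm Φ f + hardyNorm Φ g := by
  have h := hardyNorm_add_le Φ hf (hg.const_mul (-1))
  rw [hardyNorm_const_mul] at h
  simpa [sub_eq_add_neg] using h

/-! ### Dilation invariance of the Hardy norm. -/

/-- Dilating `f` by `t` turns scale `s` into scale `s / t`, and `s ↦ s / t` is a bijection of the
positive scales. -/
theorem maximalFunction_comp_div (Φ : 𝓢(ℝ, ℂ)) (f : ℝ → ℂ) {t : ℝ} (ht : 0 < t) (x : ℝ) :
    maximalFunction Φ (fun x => f (x / t)) x = maximalFunction Φ f (x / t) := by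
  have key : ∀ s : ℝ, ((fun x => f (x / t)) ⋆[ContinuousLinearMap.mul ℂ ℂ, volume] dilate Φ s) x =
      (f ⋆[ContinuousLinearMap.mul ℂ ℂ, volume] dilate Φ (s / t)) (x / t) := by
    intro s
    simp only [convolution_dilate_apply]
    have h := Measure.integral_comp_div
      (fun v => f v * (((s⁻¹ : ℝ) : ℂ) * Φ ((x - t * v) / s))) t
    simp only [mul_div_cancel₀ _ ht.ne'] at h
    rw [h, abs_of_pos ht, ← integral_smul]
    congr 1 with v
    have : (x / t - v) / (s / t) = (x - t * v) / s := by
      rw [div_sub' ht.ne', div_div_div_cancel_right₀ ht.ne']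
    rw [this, Complex.real_smul, inv_div, div_eq_mul_inv]
    push_cast
    ring
  apply le_antisymm
  · refine iSup₂_le fun s hs => ?_
    rw [key]
    exact le_iSup₂ (f := fun (t : ℝ) (_ : 0 < t) =>
      ‖(f ⋆[ContinuousLinearMap.mul ℂ ℂ, volume] dilate Φ t) _‖ₑ) (s / t) (div_pos hs ht)
  · refine iSup₂_le fun s hs => ?_
    have h := key (s * t)
    rw [mul_div_cancel_right₀ _ ht.ne'] at h
    rw [← h]
    exact le_iSup₂ (f := fun (s : ℝ) (_ : 0 < s) =>
      ‖((fun x => f (x / t)) ⋆[ContinuousLinearMap.mul ℂ ℂ, volume] dilate Φ s) x‖ₑ) (s * t)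
      (mul_pos hs ht)

theorem lintegral_comp_div_of_pos (F : ℝ → ℝ≥0∞) {t : ℝ} (ht : 0 < t) :
    ∫⁻ x, F (x / t) = ENNReal.ofReal t * ∫⁻ x, F x := by
  have h := (Homeomorph.mulRight₀ t⁻¹ (inv_ne_zero ht.ne')).measurableEmbedding.lintegral_map
    (μ := volume) F
  simp only [Homeomorph.coe_mulRight₀, ← div_eq_mul_inv] at h
  rw [← h]
  simp only [div_eq_mul_inv]
  rw [Real.map_volume_mul_right (inv_ne_zero ht.ne'), inv_inv, abs_of_pos ht,
    lintegral_smul_measure, smul_eq_mul]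

theorem hardyNorm_comp_div (Φ : 𝓢(ℝ, ℂ)) (f : ℝ → ℂ) {t : ℝ} (ht : 0 < t) :
    hardyNorm Φ (fun x => f (x / t)) = ENNReal.ofReal t * hardyNorm Φ f := by
  simp only [hardyNorm, maximalFunction_comp_div Φ f ht]
  exact lintegral_comp_div_of_pos _ ht

/-- The dilations `f ↦ t⁻¹ f(·/t)` preserve the Hardy norm. -/
theorem hardyNorm_comp_div_mul_inv (Φ : 𝓢(ℝ, ℂ)) (f : ℝ → ℂ) {t : ℝ} (ht : 0 < t) :
    hardyNorm Φ (fun x => ((t⁻¹ : ℝ) : ℂ) * f (x / t)) = hardyNorm Φ f := by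
  rw [hardyNorm_const_mul, hardyNorm_comp_div Φ f ht, ← mul_assoc, ← ofReal_norm,
    ← ENNReal.ofReal_mul (norm_nonneg _), Complex.norm_real, Real.norm_eq_abs,
    abs_of_pos (inv_pos.2 ht), inv_mul_cancel₀ ht.ne', ENNReal.ofReal_one, one_mul]

/-! ### Minkowski's inequality and boundedness of the Hausdorff operator. -/

/-- Minkowski's integral inequality for the Hardy norm. -/
theorem hardyNorm_integral_le {α : Type*} [MeasurableSpace α] (Φ : 𝓢(ℝ, ℂ)) {μ : Measure α}
    [SFinite μ] {F : α → ℝ → ℂ}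
    (hF : Integrable (Function.uncurry F) (μ.prod volume)) :
    hardyNorm Φ (fun x => ∫ t, F t x ∂μ) ≤ ∫⁻ t, hardyNorm Φ (F t) ∂μ := by
  -- `F` is measurable only almost everywhere on the product. Its strongly measurable version `G`
  -- gives a jointly measurable maximal function `M`, to which Tonelli applies.
  set G : α → ℝ → ℂ := fun t x => hF.1.mk _ (t, x) with hG
  have hGm : StronglyMeasurable (Function.uncurry G) := hF.1.stronglyMeasurable_mk
  have hFG : ∀ᵐ t ∂μ, F t =ᵐ[volume] G t := Measure.ae_ae_of_ae_prod hF.1.ae_eq_mk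
  have hGi : ∀ᵐ t ∂μ, Integrable (G t) := by
    filter_upwards [hF.prod_right_ae, hFG] with t h1 h2
    exact Integrable.congr h1 h2
  have hpt : ∀ x, maximalFunction Φ (fun x => ∫ t, F t x ∂μ) x ≤
      ∫⁻ t, maximalFunction Φ (F t) x ∂μ := by
    intro x
    refine iSup₂_le fun s hs => ?_
    have hi : Integrable (Function.uncurry fun t u =>
        F t u * (((s⁻¹ : ℝ) : ℂ) * Φ ((x - u) / s))) (μ.prod volume) := by
      refine hF.mul_bdd (c := |s⁻¹| * SchwartzMap.seminorm ℂ 0 0 Φ) ?_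
        (ae_of_all _ fun u => norm_dilate_le Φ s _)
      have h := Φ.continuous
      have : Continuous fun u : ℝ => (((s⁻¹ : ℝ) : ℂ) * Φ ((x - u) / s)) := by fun_prop
      exact (this.stronglyMeasurable.comp_measurable measurable_snd).aestronglyMeasurable
    have : ((fun x => ∫ t, F t x ∂μ) ⋆[ContinuousLinearMap.mul ℂ ℂ, volume] dilate Φ s) x =
        ∫ t, (F t ⋆[ContinuousLinearMap.mul ℂ ℂ, volume] dilate Φ s) x ∂μ := by
      simp only [convolution_dilate_apply]
      rw [integral_integral_swap hi]
      simp only [integral_mul_const]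
    rw [this]
    refine (enorm_integral_le_lintegral_enorm _).trans (lintegral_mono fun t => ?_)
    exact le_iSup₂ (f := fun (s : ℝ) (_ : 0 < s) =>
      ‖(F t ⋆[ContinuousLinearMap.mul ℂ ℂ, volume] dilate Φ s) x‖ₑ) s hs
  set M : α → ℝ → ℝ≥0∞ := fun t x => ⨆ q : {q : ℚ // 0 < q},
      ‖∫ u, G t u * ((((q.1 : ℝ)⁻¹ : ℝ) : ℂ) * Φ ((x - u) / (q.1 : ℝ)))‖ₑ with hM
  have hMm : Measurable (Function.uncurry M) :=
    Measurable.iSup fun q => (measurable_integral_mul_dilate Φ hGm q.1).enorm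
  have hMF : ∀ᵐ t ∂μ, maximalFunction Φ (F t) = M t := by
    filter_upwards [hFG, hGi] with t h1 h2
    rw [maximalFunction_congr_ae Φ h1, funext (maximalFunction_eq_iSup_rat Φ h2)]
  calc hardyNorm Φ (fun x => ∫ t, F t x ∂μ)
      ≤ ∫⁻ x, ∫⁻ t, maximalFunction Φ (F t) x ∂μ := lintegral_mono hpt
    _ = ∫⁻ x, ∫⁻ t, M t x ∂μ := by
        refine lintegral_congr fun x => lintegral_congr_ae ?_
        filter_upwards [hMF] with t ht
        rw [ht]
    _ = ∫⁻ t, ∫⁻ x : ℝ, M t x ∂volume ∂μ := (lintegral_lintegral_swap hMm.aemeasurable).symm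
    _ = ∫⁻ t, hardyNorm Φ (F t) ∂μ := by
        refine lintegral_congr_ae ?_
        filter_upwards [hMF] with t ht
        rw [hardyNorm, ht]

/-- Null sets pull back to null sets under `(t, x) ↦ x / t`. This yields both the measurability of
the kernel `f (x / t)` and the independence of the operator from the representative of `f`. -/
theorem quasiMeasurePreserving_div :
    Measure.QuasiMeasurePreserving (fun p : ℝ × ℝ => p.2 / p.1)
      ((volume.restrict (Ioi (0 : ℝ))).prod volume) volume := by
  refine QuasiMeasurePreserving.prod_of_right (by fun_prop) ?_
  filter_upwards [ae_restrict_mem measurableSet_Ioi] with t (ht : 0 < t)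
  refine ⟨by fun_prop, ?_⟩
  simp only [div_eq_mul_inv]
  rw [Real.map_volume_mul_right (inv_ne_zero ht.ne')]
  exact Measure.smul_absolutelyContinuous

theorem integrable_hausdorff_kernel {f : ℝ → ℂ} (hf : Integrable f) {ψ : ℝ → ℝ}
    (hψ : IntegrableOn ψ (Ioi 0)) :
    Integrable (Function.uncurry fun t x : ℝ => f (x / t) * ((ψ t / t : ℝ) : ℂ))
      ((volume.restrict (Ioi (0 : ℝ))).prod volume) := by
  have hm : AEStronglyMeasurable (fun t : ℝ => ((ψ t / t : ℝ) : ℂ))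
      (volume.restrict (Ioi (0 : ℝ))) :=
    Complex.continuous_ofReal.comp_aestronglyMeasurable
      (hψ.aestronglyMeasurable.aemeasurable.div aemeasurable_id).aestronglyMeasurable
  refine (integrable_prod_iff ?_).2 ⟨?_, ?_⟩
  · exact (hf.1.comp_quasiMeasurePreserving quasiMeasurePreserving_div).mul hm.comp_fst
  · filter_upwards [ae_restrict_mem measurableSet_Ioi] with t (ht : 0 < t)
    exact (hf.comp_div ht.ne').mul_const ((ψ t / t : ℝ) : ℂ)
  · refine (hψ.norm.mul_const (∫ x, ‖f x‖)).congr ?_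
    filter_upwards [ae_restrict_mem measurableSet_Ioi] with t (ht : 0 < t)
    simp only [Function.uncurry_apply_pair, norm_mul, Complex.norm_real, norm_div]
    rw [integral_mul_const, Measure.integral_comp_div (fun x => ‖f x‖) t, smul_eq_mul,
      Real.norm_eq_abs t]
    have := (abs_pos.2 ht.ne').ne'
    field_simp

theorem ae_integrableOn_hausdorff {f : ℝ → ℂ} (hf : Integrable f) {ψ : ℝ → ℝ}
    (hψ : IntegrableOn ψ (Ioi 0)) :
    ∀ᵐ x : ℝ, IntegrableOn (fun t : ℝ => f (x / t) * ((ψ t / t : ℝ) : ℂ)) (Ioi 0) :=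
  (integrable_hausdorff_kernel hf hψ).prod_left_ae

theorem integrable_hausdorff {f : ℝ → ℂ} (hf : Integrable f) {ψ : ℝ → ℝ}
    (hψ : IntegrableOn ψ (Ioi 0)) : Integrable (hausdorff ψ f) :=
  (integrable_hausdorff_kernel hf hψ).integral_prod_right

theorem hausdorff_congr_ae (ψ : ℝ → ℝ) {f g : ℝ → ℂ} (h : f =ᵐ[volume] g) :
    hausdorff ψ f =ᵐ[volume] hausdorff ψ g := by
  have h1 := quasiMeasurePreserving_div.ae h
  have h2 := Measure.ae_ae_of_ae_prod (Measure.measurePreserving_swap.quasiMeasurePreserving.ae h1)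
  filter_upwards [h2] with x hx
  refine integral_congr_ae ?_
  filter_upwards [hx] with t ht
  simp only [Prod.swap_prod_mk] at ht
  rw [ht]

theorem hausdorff_sub_ae {f : ℝ → ℂ} (hf : Integrable f) {ψ η : ℝ → ℝ}
    (hψ : IntegrableOn ψ (Ioi 0)) (hη : IntegrableOn η (Ioi 0)) :
    (fun x => hausdorff ψ f x - hausdorff η f x) =ᵐ[volume]
      hausdorff (fun t => ψ t - η t) f := by
  filter_upwards [ae_integrableOn_hausdorff hf hψ, ae_integrableOn_hausdorff hf hη] with x h1 h2
  simp only [hausdorff]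
  rw [← integral_sub h1 h2]
  congr 1 with t
  push_cast
  ring

/-- The weight may change sign because the bound is also applied to differences of logarithmic
weights. -/
theorem hardyNorm_hausdorff_le (Φ : 𝓢(ℝ, ℂ)) {f : ℝ → ℂ} (hf : Integrable f) {ψ : ℝ → ℝ}
    (hψ : IntegrableOn ψ (Ioi 0)) :
    hardyNorm Φ (hausdorff ψ f) ≤ (∫⁻ t in Ioi (0 : ℝ), ‖ψ t‖ₑ) * hardyNorm Φ f := by
  refine (hardyNorm_integral_le Φ (integrable_hausdorff_kernel hf hψ)).trans ?_
  rw [← lintegral_mul_const'' _ hψ.aestronglyMeasurable.enorm]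
  refine (setLIntegral_congr_fun measurableSet_Ioi fun t (ht : 0 < t) => ?_).le
  have : (fun x => f (x / t) * ((ψ t / t : ℝ) : ℂ)) =
      fun x => ((ψ t : ℝ) : ℂ) * (((t⁻¹ : ℝ) : ℂ) * f (x / t)) := by
    funext x
    push_cast
    ring
  rw [this, hardyNorm_const_mul, hardyNorm_comp_div_mul_inv Φ f ht]
  congr 1
  rw [← ofReal_norm, Complex.norm_real, ofReal_norm]

theorem MemH1.hausdorff {Φ : 𝓢(ℝ, ℂ)} {f : ℝ → ℂ} (hf : MemH1 Φ f) {ψ : ℝ → ℝ}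
    (hψ : IntegrableOn ψ (Ioi 0)) : MemH1 Φ (hausdorff ψ f) :=
  ⟨integrable_hausdorff hf.1 hψ,
    (hardyNorm_hausdorff_le Φ hf.1 hψ).trans_lt (ENNReal.mul_lt_top hψ.2 hf.2)⟩

/-- The Hausdorff operator is close to `∫ φ` times the identity on functions that are almost
invariant under dilations. -/
theorem hardyNorm_hausdorff_sub_le (Φ : 𝓢(ℝ, ℂ)) {f : ℝ → ℂ} (hf : Integrable f) {φ : ℝ → ℝ}
    (hφ : IntegrableOn φ (Ioi 0)) :
    hardyNorm Φ (fun x => hausdorff φ f x - ((∫ t in Ioi (0 : ℝ), φ t : ℝ) : ℂ) * f x) ≤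
      ∫⁻ t in Ioi (0 : ℝ), ‖φ t‖ₑ *
        hardyNorm Φ (fun x => ((t⁻¹ : ℝ) : ℂ) * f (x / t) - f x) := by
  have h2 : Integrable (Function.uncurry fun t x : ℝ => ((φ t : ℝ) : ℂ) * f x)
      ((volume.restrict (Ioi (0 : ℝ))).prod volume) := hφ.ofReal.mul_prod hf
  have hk := integrable_hausdorff_kernel hf hφ
  have h := hardyNorm_integral_le Φ
    (F := fun t x : ℝ => f (x / t) * ((φ t / t : ℝ) : ℂ) - ((φ t : ℝ) : ℂ) * f x) (hk.sub h2)
  have h3 : (fun x => RealHardy.hausdorff φ f x - ((∫ t in Ioi (0 : ℝ), φ t : ℝ) : ℂ) * f x)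
      =ᵐ[volume] fun x => ∫ t in Ioi (0 : ℝ),
        (f (x / t) * ((φ t / t : ℝ) : ℂ) - ((φ t : ℝ) : ℂ) * f x) := by
    filter_upwards [ae_integrableOn_hausdorff hf hφ] with x hx
    have hx' : IntegrableOn (fun t => ((φ t : ℝ) : ℂ) * f x) (Ioi 0) :=
      Integrable.mul_const (Integrable.ofReal hφ) _
    rw [integral_sub hx hx', integral_mul_const, integral_complex_ofReal]
    rfl
  rw [hardyNorm_congr_ae Φ h3]
  refine h.trans (setLIntegral_congr_fun measurableSet_Ioi fun t (ht : 0 < t) => ?_).le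
  have : (fun x => f (x / t) * ((φ t / t : ℝ) : ℂ) - ((φ t : ℝ) : ℂ) * f x) =
      fun x => ((φ t : ℝ) : ℂ) * (((t⁻¹ : ℝ) : ℂ) * f (x / t) - f x) := by
    funext x
    push_cast
    ring
  rw [this, hardyNorm_const_mul]
  congr 1
  rw [← ofReal_norm, Complex.norm_real, ofReal_norm]

/-- Substituting `s ↦ t s` moves a dilation from the output to the weight, so the dilation defect of
an average is controlled by an `L¹` difference of weights. -/
theorem inv_mul_hausdorff_div (ψ : ℝ → ℝ) (f : ℝ → ℂ) {t : ℝ} (ht : 0 < t) (x : ℝ) :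
    ((t⁻¹ : ℝ) : ℂ) * hausdorff ψ f (x / t) = hausdorff (fun s => t⁻¹ * ψ (s / t)) f x := by
  have h := integral_comp_mul_left_Ioi
    (fun s => f (x / s) * ((t⁻¹ * ψ (s / t) / s : ℝ) : ℂ)) 0 ht
  rw [mul_zero] at h
  have h' : hausdorff (fun s => t⁻¹ * ψ (s / t)) f x = (t : ℂ) *
      ∫ s in Ioi (0 : ℝ), f (x / (t * s)) * ((t⁻¹ * ψ (t * s / t) / (t * s) : ℝ) : ℂ) := by
    rw [h, Complex.real_smul, ← mul_assoc, ← Complex.ofReal_mul, mul_inv_cancel₀ ht.ne',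
      Complex.ofReal_one, one_mul]
    rfl
  rw [h', hausdorff, ← integral_const_mul, ← integral_const_mul]
  congr 1 with s
  rw [mul_div_cancel_left₀ _ ht.ne', div_div]
  have : (t : ℂ) ≠ 0 := by exact_mod_cast ht.ne'
  push_cast
  field_simp

/-! ### The step function `haar` in `H¹`, and a pointwise lower bound for the maximal function. -/

/-- The odd step function `1_(0,1) - 1_(-1,0)`. -/
noncomputable def haar (x : ℝ) : ℂ :=
  (Ioo (0 : ℝ) 1).indicator 1 x - (Ioo (-1 : ℝ) 0).indicator 1 x

theorem integrable_haar : Integrable haar := by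
  have h : ∀ a b : ℝ, Integrable ((Ioo a b).indicator (1 : ℝ → ℂ)) := fun a b =>
    (integrable_indicator_iff measurableSet_Ioo).2
      (integrableOn_const (C := (1 : ℂ)) (by simp))
  exact (h 0 1).sub (h (-1) 0)

theorem integral_haar : ∫ x, haar x = 0 := by
  have h : ∀ a b : ℝ, Integrable ((Ioo a b).indicator (1 : ℝ → ℂ)) := fun a b =>
    (integrable_indicator_iff measurableSet_Ioo).2
      (integrableOn_const (C := (1 : ℂ)) (by simp))
  simp only [haar]
  rw [integral_sub (h 0 1) (h (-1) 0), integral_indicator measurableSet_Ioo,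
    integral_indicator measurableSet_Ioo]
  simp

theorem norm_haar_le_indicator (x : ℝ) : ‖haar x‖ ≤ (Ioo (-1 : ℝ) 1).indicator 1 x := by
  by_cases h1 : x ∈ Ioo (0 : ℝ) 1
  · have h2 : x ∉ Ioo (-1 : ℝ) 0 := fun h => h.2.not_gt h1.1
    have h3 : x ∈ Ioo (-1 : ℝ) 1 := ⟨by linarith [h1.1], h1.2⟩
    simp [haar, h1, h2, h3]
  · by_cases h2 : x ∈ Ioo (-1 : ℝ) 0
    · have h3 : x ∈ Ioo (-1 : ℝ) 1 := ⟨h2.1, by linarith [h2.2]⟩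
      simp [haar, h1, h2, h3]
    · simp only [haar, h1, h2, not_false_eq_true, indicator_of_notMem, sub_self, norm_zero]
      exact indicator_nonneg (fun _ _ => zero_le_one) _

theorem norm_haar_le_one (x : ℝ) : ‖haar x‖ ≤ 1 :=
  (norm_haar_le_indicator x).trans (indicator_le_self' (fun _ _ => zero_le_one) x)

theorem haar_of_mem {x : ℝ} (h0 : 0 < x) (h1 : x < 1) : haar x = 1 := by
  have h2 : x ∉ Ioo (-1 : ℝ) 0 := fun h => h.2.not_gt h0
  simp [haar, show x ∈ Ioo (0 : ℝ) 1 from ⟨h0, h1⟩, h2]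

theorem haar_of_one_le {x : ℝ} (h1 : 1 ≤ x) : haar x = 0 := by
  have h2 : x ∉ Ioo (-1 : ℝ) 0 := fun h => by linarith [h.2]
  have h3 : x ∉ Ioo (0 : ℝ) 1 := fun h => by linarith [h.2]
  simp [haar, h2, h3]

/-- The derivative of `Φ_s` at `y` has size `s⁻² |Φ'(y/s)|`, and quadratic decay of `Φ'` bounds it
by a multiple of `1 / y²`, in which `s` has cancelled. On the segment `|y| ≥ |x| / 2`, whence the
factor 4. -/
theorem exists_norm_dilate_sub_le (Φ : 𝓢(ℝ, ℂ)) : ∃ C : ℝ, 0 < C ∧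
    ∀ s x u : ℝ, 0 < s → 2 ≤ |x| → |u| ≤ 1 →
      ‖dilate Φ s (x - u) - dilate Φ s x‖ ≤ C / x ^ 2 := by
  obtain ⟨C, hC, h⟩ := (SchwartzMap.derivCLM ℂ ℂ Φ).decay 2 0
  simp only [norm_iteratedFDeriv_zero, SchwartzMap.derivCLM_apply] at h
  refine ⟨4 * C, by positivity, fun s x u hs hx hu => ?_⟩
  have hd : ∀ y : ℝ, HasDerivAt (dilate Φ s)
      (((s⁻¹ : ℝ) : ℂ) * ((s⁻¹ : ℝ) • deriv Φ (y / s))) y := by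
    intro y
    have h1 : HasDerivAt (fun y : ℝ => y / s) s⁻¹ y := by
      simpa [div_eq_mul_inv] using (hasDerivAt_id y).mul_const s⁻¹
    exact ((Φ.differentiable _).hasDerivAt.scomp y h1).const_mul _
  have hb : ∀ y ∈ Icc (x - 1) (x + 1), ‖deriv (dilate Φ s) y‖ ≤ 4 * C / x ^ 2 := by
    intro y hy
    have hyx : |x| / 2 ≤ |y| := by
      have h1 : |x - y| ≤ 1 := abs_le.2 ⟨by linarith [hy.2], by linarith [hy.1]⟩
      have h2 := abs_sub_abs_le_abs_sub x y
      linarith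
    have hx2 : 0 < x ^ 2 := by rw [← sq_abs]; positivity
    have hy2 : x ^ 2 / 4 ≤ y ^ 2 := by
      rw [← sq_abs x, ← sq_abs y]
      nlinarith [abs_nonneg x]
    have h3 := h (y / s)
    rw [Real.norm_eq_abs, sq_abs, div_pow] at h3
    rw [(hd y).deriv, norm_mul, norm_smul, Complex.norm_real, Real.norm_eq_abs,
      abs_of_pos (inv_pos.2 hs), le_div_iff₀ hx2]
    calc s⁻¹ * (s⁻¹ * ‖deriv Φ (y / s)‖) * x ^ 2
        = 4 * ((x ^ 2 / 4) / s ^ 2 * ‖deriv Φ (y / s)‖) := by field_simp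
      _ ≤ 4 * (y ^ 2 / s ^ 2 * ‖deriv Φ (y / s)‖) := by gcongr
      _ ≤ 4 * C := by gcongr
  have hxu := abs_le.1 hu
  have := (convex_Icc (x - 1) (x + 1)).norm_image_sub_le_of_norm_deriv_le
    (fun y _ => (hd y).differentiableAt) hb (x := x) (y := x - u)
    ⟨by linarith, by linarith⟩ ⟨by linarith, by linarith⟩
  refine this.trans ?_
  rw [Real.norm_eq_abs, sub_sub_cancel_left, abs_neg]
  exact mul_le_of_le_one_right (by positivity) hu

/-- Near the origin `M_Φ haar ≤ ‖Φ‖₁`. Far away the zero mean allows `Φ_s(x)` to be subtracted from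
the kernel, which leaves integrable decay `1 / x²`. -/
theorem memH1_haar (Φ : 𝓢(ℝ, ℂ)) : MemH1 Φ haar := by
  refine ⟨integrable_haar, ?_⟩
  obtain ⟨C, hC, hΦ⟩ := exists_norm_dilate_sub_le Φ
  set I := ∫ x, ‖Φ x‖ with hI
  have hI0 : 0 ≤ I := integral_nonneg fun _ => norm_nonneg _
  have hsmall : ∀ s x : ℝ, 0 < s →
      ‖(haar ⋆[ContinuousLinearMap.mul ℂ ℂ, volume] dilate Φ s) x‖ ≤ I := by
    intro s x hs
    rw [convolution_dilate_apply]
    have h1 : Integrable fun u => ‖((s⁻¹ : ℝ) : ℂ) * Φ (u / s)‖ :=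
      ((Φ.integrable.comp_div hs.ne').const_mul _).norm
    have h2 : ∫ u, ‖((s⁻¹ : ℝ) : ℂ) * Φ ((x - u) / s)‖ = I := by
      rw [integral_sub_left_eq_self (fun u => ‖((s⁻¹ : ℝ) : ℂ) * Φ (u / s)‖) volume x]
      simp only [norm_mul, integral_const_mul]
      rw [Measure.integral_comp_div (fun u => ‖Φ u‖) s, Complex.norm_real, Real.norm_eq_abs,
        smul_eq_mul, abs_of_pos hs, abs_of_pos (inv_pos.2 hs), inv_mul_cancel_left₀ hs.ne']
    rw [← h2]
    refine norm_integral_le_of_norm_le (h1.comp_sub_left x) (ae_of_all _ fun u => ?_)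
    rw [norm_mul]
    exact mul_le_of_le_one_left (norm_nonneg _) (norm_haar_le_one u)
  have hlarge : ∀ s x : ℝ, 0 < s → 2 ≤ |x| →
      ‖(haar ⋆[ContinuousLinearMap.mul ℂ ℂ, volume] dilate Φ s) x‖ ≤ 2 * (C / x ^ 2) := by
    intro s x hs hx
    have h0 : (haar ⋆[ContinuousLinearMap.mul ℂ ℂ, volume] dilate Φ s) x =
        ∫ u, haar u * (dilate Φ s (x - u) - dilate Φ s x) := by
      simp only [mul_sub]
      have hi : Integrable fun u => haar u * dilate Φ s (x - u) :=
        integrable_mul_dilate Φ integrable_haar s x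
      rw [integral_sub hi
        (integrable_haar.mul_const _), integral_mul_const, integral_haar, zero_mul, sub_zero]
      rfl
    have h1 : ∫ u, (Ioo (-1 : ℝ) 1).indicator (fun _ => C / x ^ 2) u = 2 * (C / x ^ 2) := by
      rw [integral_indicator measurableSet_Ioo]
      simp
      norm_num
    rw [h0, ← h1]
    refine norm_integral_le_of_norm_le ((integrable_indicator_iff measurableSet_Ioo).2
      (integrableOn_const (by simp))) (ae_of_all _ fun u => ?_)
    rw [norm_mul]
    by_cases hu : u ∈ Ioo (-1 : ℝ) 1
    · rw [indicator_of_mem hu]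
      exact (mul_le_of_le_one_left (norm_nonneg _) (norm_haar_le_one u)).trans
        (hΦ s x u hs hx (abs_le.2 ⟨hu.1.le, hu.2.le⟩))
    · have := norm_haar_le_indicator u
      rw [indicator_of_notMem hu] at this ⊢
      rw [le_antisymm this (norm_nonneg _), zero_mul]
  -- One integrable majorant for both ranges: `1 + x² ≤ 5` when `|x| < 2`, and `1 + x² ≤ 2 x²` when
  -- `|x| ≥ 2`.
  have hbound : ∀ x, maximalFunction Φ haar x ≤
      ENNReal.ofReal ((5 * I + 4 * C) * (1 + x ^ 2)⁻¹) := by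
    intro x
    refine iSup₂_le fun s hs => ?_
    rw [← ofReal_norm]
    refine ENNReal.ofReal_le_ofReal ?_
    have hx1 : 0 < 1 + x ^ 2 := by positivity
    rw [← div_eq_mul_inv]
    rcases le_or_gt 2 |x| with hx | hx
    · refine (hlarge s x hs hx).trans ?_
      have hx2 : 4 ≤ x ^ 2 := by
        rw [← sq_abs]
        nlinarith
      rw [← mul_div_assoc, div_le_div_iff₀ (by linarith) hx1]
      nlinarith [mul_nonneg hI0 (sq_nonneg x)]
    · refine (hsmall s x hs).trans ?_
      have hx2 : x ^ 2 ≤ 4 := by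
        rw [← sq_abs]
        nlinarith [abs_nonneg x]
      rw [le_div_iff₀ hx1]
      nlinarith
  refine (lintegral_mono hbound).trans_lt ?_
  exact (integrable_inv_one_add_sq.const_mul _).lintegral_lt_top

/-- As `s → 0` the convolutions `f * Φ_s (x)` tend to `f x * ∫ Φ`; the bound `B` provides
domination. -/
theorem enorm_mul_le_maximalFunction (Φ : 𝓢(ℝ, ℂ)) {f : ℝ → ℂ} (hf : AEStronglyMeasurable f)
    {B : ℝ} (hB : ∀ y, ‖f y‖ ≤ B) {x : ℝ} (hx : ContinuousAt f x) :
    ‖f x‖ₑ * ‖∫ y, Φ y‖ₑ ≤ maximalFunction Φ f x := by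
  have key : ∀ s : ℝ, 0 < s → (f ⋆[ContinuousLinearMap.mul ℂ ℂ, volume] dilate Φ s) x =
      ∫ v, f (x - s * v) * Φ v := by
    intro s hs
    rw [convolution_dilate_apply, ← integral_sub_left_eq_self _ volume x]
    simp only [sub_sub_cancel]
    have h := Measure.integral_comp_div
      (fun v => f (x - s * v) * (((s⁻¹ : ℝ) : ℂ) * Φ v)) s
    simp only [mul_div_cancel₀ _ hs.ne'] at h
    rw [h, abs_of_pos hs, ← integral_smul]
    congr 1 with v
    have : (s : ℂ) ≠ 0 := by exact_mod_cast hs.ne'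
    rw [Complex.real_smul]
    push_cast
    field_simp
  have hmeas : ∀ s : ℝ, 0 < s → AEStronglyMeasurable (fun v => f (x - s * v)) := by
    intro s hs
    have hq : Measure.QuasiMeasurePreserving (fun v : ℝ => s * v) volume volume := by
      refine ⟨by fun_prop, ?_⟩
      rw [Real.map_volume_mul_left hs.ne']
      exact Measure.smul_absolutelyContinuous
    exact hf.comp_quasiMeasurePreserving
      ((Measure.measurePreserving_sub_left volume x).quasiMeasurePreserving.comp hq)
  have hlim : Tendsto (fun s : ℝ => ∫ v, f (x - s * v) * Φ v) (𝓝[>] 0)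
      (𝓝 (∫ v, f x * Φ v)) := by
    refine tendsto_integral_filter_of_dominated_convergence (fun v => B * ‖Φ v‖) ?_ ?_
      (Φ.integrable.norm.const_mul B) (ae_of_all _ fun v => ?_)
    · filter_upwards [self_mem_nhdsWithin] with s hs
      exact (hmeas s hs).mul Φ.continuous.aestronglyMeasurable
    · refine .of_forall fun s => ae_of_all _ fun v => ?_
      rw [norm_mul]
      gcongr
      exact hB _
    · refine Tendsto.mul_const _ (hx.tendsto.comp ?_)
      have : Tendsto (fun s : ℝ => x - s * v) (𝓝 0) (𝓝 (x - 0 * v)) :=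
        Continuous.tendsto (by fun_prop) 0
      rw [zero_mul, sub_zero] at this
      exact this.mono_left nhdsWithin_le_nhds
  rw [integral_const_mul] at hlim
  rw [← enorm_mul]
  refine le_of_tendsto hlim.enorm ?_
  filter_upwards [self_mem_nhdsWithin] with s (hs : 0 < s)
  rw [← key s hs]
  exact le_iSup₂ (f := fun (t : ℝ) (_ : 0 < t) =>
    ‖(f ⋆[ContinuousLinearMap.mul ℂ ℂ, volume] dilate Φ t) x‖ₑ) s hs

/-! ### Logarithmic averages: almost invariance under dilations and growth of the norm. -/

/-- The weight `1_(a,b](s) / s`, of mass `log (b / a)`. -/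
noncomputable def logWeight (a b : ℝ) : ℝ → ℝ := (Ioc a b).indicator fun s => s⁻¹

theorem integrableOn_inv_uIoc {a b : ℝ} (ha : 0 < a) (hb : 0 < b) :
    IntegrableOn (fun s : ℝ => s⁻¹) (uIoc a b) :=
  intervalIntegrable_iff.1 (intervalIntegral.intervalIntegrable_inv
    (fun _ hx => ((lt_min ha hb).trans_le hx.1).ne') continuousOn_id)

theorem integrable_logWeight {a b : ℝ} (ha : 0 < a) (hab : a ≤ b) :
    Integrable (logWeight a b) := by
  refine (integrable_indicator_iff measurableSet_Ioc).2 ?_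
  rw [← uIoc_of_le hab]
  exact integrableOn_inv_uIoc ha (ha.trans_le hab)

theorem lintegral_enorm_inv_uIoc {a b : ℝ} (ha : 0 < a) (hb : 0 < b) :
    ∫⁻ s in uIoc a b, ‖s⁻¹‖ₑ = ENNReal.ofReal |Real.log (b / a)| := by
  wlog hab : a ≤ b generalizing a b
  · rw [uIoc_comm, this hb ha (le_of_not_ge hab), ← abs_neg, ← Real.log_inv, inv_div]
  rw [← ofReal_integral_norm_eq_lintegral_enorm (integrableOn_inv_uIoc ha hb),
    uIoc_of_le hab]
  have : ∫ s in Ioc a b, ‖s⁻¹‖ = ∫ s in Ioc a b, s⁻¹ :=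
    setIntegral_congr_fun measurableSet_Ioc fun s hs =>
      Real.norm_of_nonneg (inv_nonneg.2 (ha.trans hs.1).le)
  rw [this, ← intervalIntegral.integral_of_le hab, integral_inv_of_pos ha hb,
    abs_of_nonneg (Real.log_nonneg ((one_le_div ha).2 hab))]

theorem inv_mul_logWeight_div {t : ℝ} (ht : 0 < t) (a b s : ℝ) :
    t⁻¹ * logWeight a b (s / t) = logWeight (t * a) (t * b) s := by
  have h : s / t ∈ Ioc a b ↔ s ∈ Ioc (t * a) (t * b) := by
    simp only [mem_Ioc, lt_div_iff₀ ht, div_le_iff₀ ht, mul_comm]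
  by_cases hs : s ∈ Ioc (t * a) (t * b)
  · simp only [logWeight, indicator_of_mem hs, indicator_of_mem (h.2 hs)]
    rw [inv_div]
    field_simp
  · simp only [logWeight, indicator_of_notMem hs, indicator_of_notMem (mt h.1 hs), mul_zero]

/-- The two weights agree off the intervals between `a`, `t a` and between `b`, `t b`, each of mass
`|log t|` for `ds/s`. The bound does not depend on `a` and `b`. -/
theorem lintegral_enorm_logWeight_sub_le {a b t : ℝ} (ha : 0 < a) (hab : a ≤ b) (ht : 0 < t) :
    ∫⁻ s in Ioi (0 : ℝ), ‖logWeight (t * a) (t * b) s - logWeight a b s‖ₑ ≤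
      ENNReal.ofReal (2 * |Real.log t|) := by
  have hb := ha.trans_le hab
  have hpt : ∀ s, ‖logWeight (t * a) (t * b) s - logWeight a b s‖ₑ ≤
      (uIoc a (t * a)).indicator (fun s => ‖s⁻¹‖ₑ) s +
      (uIoc b (t * b)).indicator (fun s => ‖s⁻¹‖ₑ) s := by
    intro s
    have hle : s ∈ uIoc a (t * a) ∪ uIoc b (t * b) → ‖s⁻¹‖ₑ ≤
        (uIoc a (t * a)).indicator (fun s => ‖s⁻¹‖ₑ) s +
        (uIoc b (t * b)).indicator (fun s => ‖s⁻¹‖ₑ) s := by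
      rintro (h | h)
      · rw [indicator_of_mem h]
        exact le_self_add
      · rw [indicator_of_mem h (fun s : ℝ => ‖s⁻¹‖ₑ)]
        exact le_add_self
    by_cases h1 : s ∈ Ioc (t * a) (t * b) <;> by_cases h2 : s ∈ Ioc a b
    · simp [logWeight, h1, h2]
    · simp only [logWeight, indicator_of_mem h1, indicator_of_notMem h2, sub_zero]
      apply hle
      rw [mem_union, mem_uIoc, mem_uIoc]
      simp only [mem_Ioc] at h1 h2
      grind
    · simp only [logWeight, indicator_of_mem h2, indicator_of_notMem h1, zero_sub, enorm_neg]
      apply hle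
      rw [mem_union, mem_uIoc, mem_uIoc]
      simp only [mem_Ioc] at h1 h2
      grind
    · simp [logWeight, h1, h2]
  calc ∫⁻ s in Ioi (0 : ℝ), ‖logWeight (t * a) (t * b) s - logWeight a b s‖ₑ
      ≤ ∫⁻ s, ‖logWeight (t * a) (t * b) s - logWeight a b s‖ₑ := setLIntegral_le_lintegral _ _
    _ ≤ ∫⁻ s, ((uIoc a (t * a)).indicator (fun s => ‖s⁻¹‖ₑ) s +
          (uIoc b (t * b)).indicator (fun s => ‖s⁻¹‖ₑ) s) := lintegral_mono hpt
    _ = ENNReal.ofReal (2 * |Real.log t|) := by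
      rw [lintegral_add_left (Measurable.indicator (by fun_prop) measurableSet_uIoc),
        lintegral_indicator measurableSet_uIoc, lintegral_indicator measurableSet_uIoc,
        lintegral_enorm_inv_uIoc ha (mul_pos ht ha), lintegral_enorm_inv_uIoc hb (mul_pos ht hb),
        mul_div_cancel_right₀ _ ha.ne', mul_div_cancel_right₀ _ hb.ne',
        ← ENNReal.ofReal_add (abs_nonneg _) (abs_nonneg _), two_mul]

/-- Logarithmic averages `∫_1^N s⁻¹ f(x/s) ds/s` of the dilates of `f` over `1 < s ≤ N`. -/
noncomputable def logAverage (N : ℝ) (f : ℝ → ℂ) : ℝ → ℂ := hausdorff (logWeight 1 N) f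

theorem hardyNorm_logAverage_dilate_sub_le (Φ : 𝓢(ℝ, ℂ)) {f : ℝ → ℂ} (hf : Integrable f)
    {N t : ℝ} (hN : 1 ≤ N) (ht : 0 < t) :
    hardyNorm Φ (fun x => ((t⁻¹ : ℝ) : ℂ) * logAverage N f (x / t) - logAverage N f x) ≤
      ENNReal.ofReal (2 * |Real.log t|) * hardyNorm Φ f := by
  have hi : ∀ {a b : ℝ}, 0 < a → a ≤ b → IntegrableOn (logWeight a b) (Ioi 0) :=
    fun ha hab => (integrable_logWeight ha hab).integrableOn
  have h1 := hi one_pos hN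
  have h2 := hi (mul_pos ht one_pos) (mul_le_mul_of_nonneg_left hN ht.le)
  have h3 : (fun x => ((t⁻¹ : ℝ) : ℂ) * logAverage N f (x / t) - logAverage N f x) =
      fun x => hausdorff (logWeight (t * 1) (t * N)) f x - hausdorff (logWeight 1 N) f x := by
    funext x
    rw [logAverage, inv_mul_hausdorff_div _ _ ht]
    simp only [inv_mul_logWeight_div ht]
  rw [h3, hardyNorm_congr_ae Φ (hausdorff_sub_ae hf h2 h1)]
  refine (hardyNorm_hausdorff_le Φ hf (h2.sub h1)).trans ?_
  gcongr
  exact lintegral_enorm_logWeight_sub_le one_pos hN ht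

theorem norm_logAverage_haar_le {N : ℝ} (hN : 1 ≤ N) (x : ℝ) :
    ‖logAverage N haar x‖ ≤ ∫ s in Ioi (0 : ℝ), logWeight 1 N s := by
  refine norm_integral_le_of_norm_le (integrable_logWeight one_pos hN).integrableOn
    (ae_of_all _ fun s => ?_)
  rw [norm_mul, Complex.norm_real]
  refine (mul_le_of_le_one_left (norm_nonneg _) (norm_haar_le_one _)).trans ?_
  by_cases hs : s ∈ Ioc 1 N
  · have h1 : 0 < s := one_pos.trans hs.1
    rw [logWeight, indicator_of_mem hs, Real.norm_of_nonneg (by positivity)]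
    exact div_le_self (by positivity) hs.1.le
  · simp [logWeight, indicator_of_notMem hs]

/-- For `x > 0` the factor `haar (x / s)` is 1 exactly when `s > x`, so the average is `∫_x^N s⁻²
ds`. -/
theorem logAverage_haar_apply {N x : ℝ} (hx1 : 1 < x) (hxN : x < N) :
    logAverage N haar x = ((x⁻¹ - N⁻¹ : ℝ) : ℂ) := by
  have hx0 : 0 < x := one_pos.trans hx1
  have h : ∀ s ∈ Ioi (0 : ℝ), haar (x / s) * ((logWeight 1 N s / s : ℝ) : ℂ) =
      (((Ioc x N).indicator (fun s : ℝ => s ^ (-2 : ℤ)) s : ℝ) : ℂ) := by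
    intro s (hs : 0 < s)
    rcases le_or_gt s x with hsx | hsx
    · rw [haar_of_one_le ((one_le_div hs).2 hsx), indicator_of_notMem fun h => h.1.not_ge hsx]
      simp
    · rw [haar_of_mem (div_pos hx0 hs) ((div_lt_one hs).2 hsx), one_mul]
      congr 1
      by_cases hsN : s ≤ N
      · rw [logWeight, indicator_of_mem (show s ∈ Ioc 1 N from ⟨hx1.trans hsx, hsN⟩),
          indicator_of_mem (show s ∈ Ioc x N from ⟨hsx, hsN⟩),
          zpow_neg, div_eq_mul_inv, ← mul_inv, zpow_ofNat, sq]
      · rw [logWeight, indicator_of_notMem fun h => hsN h.2,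
          indicator_of_notMem fun h => hsN h.2, zero_div]
  rw [logAverage, hausdorff, setIntegral_congr_fun measurableSet_Ioi h, integral_complex_ofReal,
    setIntegral_indicator measurableSet_Ioc, inter_eq_right.2 (show Ioc x N ⊆ Ioi 0 from fun s hs => hx0.trans hs.1),
    ← intervalIntegral.integral_of_le hxN.le, integral_zpow]
  · norm_num
    ring
  · refine Or.inr ⟨by norm_num, fun h => ?_⟩
    rw [uIcc_of_le hxN.le] at h
    exact hx0.not_ge h.1

theorem le_hardyNorm_logAverage_haar (Φ : 𝓢(ℝ, ℂ)) {N : ℝ} (hN : 1 ≤ N) :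
    ENNReal.ofReal (Real.log N - 1) * ‖∫ y, Φ y‖ₑ ≤ hardyNorm Φ (logAverage N haar) := by
  have hpt : ∀ x ∈ Ioo 1 N, ENNReal.ofReal (x⁻¹ - N⁻¹) * ‖∫ y, Φ y‖ₑ ≤
      maximalFunction Φ (logAverage N haar) x := by
    intro x hx
    have hc : ContinuousAt (logAverage N haar) x := by
      have h : ContinuousAt (fun x : ℝ => ((x⁻¹ - N⁻¹ : ℝ) : ℂ)) x :=
        Complex.continuous_ofReal.continuousAt.comp
          ((continuousAt_inv₀ (one_pos.trans hx.1).ne').sub continuousAt_const)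
      refine h.congr ?_
      filter_upwards [Ioo_mem_nhds hx.1 hx.2] with y hy
      exact (logAverage_haar_apply hy.1 hy.2).symm
    have h := enorm_mul_le_maximalFunction Φ (f := logAverage N haar)
      (integrable_hausdorff integrable_haar (integrable_logWeight one_pos hN).integrableOn).1
      (norm_logAverage_haar_le hN) hc
    rw [logAverage_haar_apply hx.1 hx.2, ← ofReal_norm, Complex.norm_real,
      Real.norm_of_nonneg] at h
    · exact h
    · exact sub_nonneg.2 (inv_anti₀ (one_pos.trans hx.1) hx.2.le)
  have hint : IntegrableOn (fun x : ℝ => x⁻¹ - N⁻¹) (Ioc 1 N) := by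
    have h := integrableOn_inv_uIoc one_pos (one_pos.trans_le hN)
    rw [uIoc_of_le hN] at h
    exact h.sub (integrableOn_const (by simp))
  calc ENNReal.ofReal (Real.log N - 1) * ‖∫ y, Φ y‖ₑ
      ≤ ENNReal.ofReal (∫ x in Ioc 1 N, (x⁻¹ - N⁻¹)) * ‖∫ y, Φ y‖ₑ := by
        gcongr
        -- The integral equals `log N - 1 + 1/N`; the last term is dropped.
        have h0 := one_pos.trans_le hN
        have hii : IntervalIntegrable (fun x : ℝ => x⁻¹) volume 1 N :=
          intervalIntegrable_iff.2 (integrableOn_inv_uIoc one_pos h0)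
        rw [← intervalIntegral.integral_of_le hN, intervalIntegral.integral_sub hii (by simp),
          integral_inv_of_pos one_pos h0, intervalIntegral.integral_const, div_one, smul_eq_mul,
          sub_mul, mul_inv_cancel₀ h0.ne', one_mul]
        have := inv_nonneg.2 h0.le
        linarith
    _ = ∫⁻ x in Ioo 1 N, ENNReal.ofReal (x⁻¹ - N⁻¹) * ‖∫ y, Φ y‖ₑ := by
        rw [lintegral_mul_const' _ _ enorm_ne_top, ofReal_integral_eq_lintegral_ofReal hint,
          restrict_Ioo_eq_restrict_Ioc]
        filter_upwards [ae_restrict_mem measurableSet_Ioc] with x hx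
        exact sub_nonneg.2 (inv_anti₀ (one_pos.trans hx.1) hx.2)
    _ ≤ ∫⁻ x in Ioo 1 N, maximalFunction Φ (logAverage N haar) x :=
        setLIntegral_mono' measurableSet_Ioo hpt
    _ ≤ hardyNorm Φ (logAverage N haar) := setLIntegral_le_lintegral _ _

theorem tendsto_hardyNorm_logAverage_haar {Φ : 𝓢(ℝ, ℂ)} (hΦ : (∫ x, Φ x) ≠ 0) :
    Tendsto (fun n : ℕ => hardyNorm Φ (logAverage (n + 1) haar)) atTop (𝓝 ∞) := by
  have h1 : Tendsto (fun n : ℕ => ((n : ℝ) + 1)) atTop atTop :=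
    tendsto_atTop_add_const_right _ _ tendsto_natCast_atTop_atTop
  have h2 : Tendsto (fun n : ℕ => ENNReal.ofReal (Real.log ((n : ℝ) + 1) - 1)) atTop (𝓝 ∞) :=
    ENNReal.tendsto_ofReal_atTop.comp
      (tendsto_atTop_add_const_right _ (-1) (Real.tendsto_log_atTop.comp h1))
  have h3 := ENNReal.Tendsto.mul_const (b := ‖∫ y, Φ y‖ₑ) h2 (Or.inl ENNReal.top_ne_zero)
  -- The nonvanishing of `∫ Φ` enters the argument here.
  rw [ENNReal.top_mul (by simpa using hΦ)] at h3
  exact tendsto_of_tendsto_of_tendsto_of_le_of_le h3 tendsto_const_nhds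
    (fun n => le_hardyNorm_logAverage_haar Φ (by simp)) fun n => le_top

/-! ### The operator norm. -/

theorem hausdorff_const_mul (φ : ℝ → ℝ) (c : ℂ) (f : ℝ → ℂ) :
    hausdorff φ (fun x => c * f x) = fun x => c * hausdorff φ f x := by
  funext x
  simp only [hausdorff, mul_assoc, integral_const_mul]

theorem hardyNorm_hausdorff_le_opNormH1_mul {Φ : 𝓢(ℝ, ℂ)} (φ : ℝ → ℝ) {f : ℝ → ℂ}
    (hf : MemH1 Φ f) (h0 : hardyNorm Φ f ≠ 0) :
    hardyNorm Φ (hausdorff φ f) ≤ opNormH1 Φ (hausdorff φ) * hardyNorm Φ f := by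
  set h := hardyNorm Φ f with hh
  have htop : h ≠ ∞ := hf.2.ne
  set c : ℂ := ((h.toReal⁻¹ : ℝ) : ℂ) with hc
  have hcn : ‖c‖ₑ = h⁻¹ := by
    rw [← ofReal_norm, hc, Complex.norm_real, Real.norm_of_nonneg (by positivity),
      ENNReal.ofReal_inv_of_pos (ENNReal.toReal_pos h0 htop), ENNReal.ofReal_toReal htop]
  have h1 : hardyNorm Φ (fun x => c * f x) = 1 := by
    rw [hardyNorm_const_mul, hcn, ENNReal.inv_mul_cancel h0 htop]
  have h2 : hardyNorm Φ (hausdorff φ fun x => c * f x) ≤ opNormH1 Φ (hausdorff φ) :=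
    le_iSup₂ (f := fun (f : ℝ → ℂ) (_ : MemH1 Φ f ∧ hardyNorm Φ f ≤ 1) =>
      hardyNorm Φ (hausdorff φ f)) (fun x => c * f x)
      ⟨⟨hf.1.const_mul c, h1 ▸ ENNReal.one_lt_top⟩, h1.le⟩
  rwa [hausdorff_const_mul, hardyNorm_const_mul, hcn, mul_comm, ← div_eq_mul_inv,
    ENNReal.div_le_iff h0 htop] at h2

theorem opNormH1_hausdorff_le (Φ : 𝓢(ℝ, ℂ)) {φ : ℝ → ℝ} (hφ : IntegrableOn φ (Ioi 0)) :
    opNormH1 Φ (hausdorff φ) ≤ ∫⁻ t in Ioi (0 : ℝ), ‖φ t‖ₑ := by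
  refine iSup₂_le fun f hf => (hardyNorm_hausdorff_le Φ hf.1.1 hφ).trans ?_
  exact mul_le_of_le_one_right' hf.2

theorem enorm_integral_le_opNormH1_hausdorff {Φ : 𝓢(ℝ, ℂ)} (hΦ : (∫ x, Φ x) ≠ 0)
    {φ : ℝ → ℝ} (hφ : IntegrableOn φ (Ioi 0)) :
    ‖∫ t in Ioi (0 : ℝ), φ t‖ₑ ≤ opNormH1 Φ (hausdorff φ) := by
  set A := ∫ t in Ioi (0 : ℝ), φ t with hA
  set K := hardyNorm Φ haar with hK
  have hKtop : K ≠ ∞ := (memH1_haar Φ).2.ne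
  set h : ℕ → ℝ≥0∞ := fun n => hardyNorm Φ (logAverage (n + 1) haar) with hh
  have hlim : Tendsto h atTop (𝓝 ∞) := tendsto_hardyNorm_logAverage_haar hΦ
  -- `φ(t) log t` need not be integrable, so the logarithmic bound alone gives no domination. The
  -- constant 2, from the triangle inequality and dilation invariance, gives the majorant `2 |φ|`;
  -- the other entry of the minimum gives pointwise convergence to 0.
  set G : ℕ → ℝ → ℝ≥0∞ := fun n t =>
    ‖φ t‖ₑ * min 2 (ENNReal.ofReal (2 * |Real.log t|) * K / h n) with hG
  have hstep : ∀ n, h n ≠ 0 →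
      ‖A‖ₑ ≤ opNormH1 Φ (hausdorff φ) + ∫⁻ t in Ioi (0 : ℝ), G n t := by
    intro n hn0
    have hN : (1 : ℝ) ≤ n + 1 := by simp
    set f := logAverage ((n : ℝ) + 1) haar with hf
    have hfm : MemH1 Φ f :=
      (memH1_haar Φ).hausdorff (integrable_logWeight one_pos hN).integrableOn
    have hntop : h n ≠ ∞ := hfm.2.ne
    have hHf := hfm.hausdorff hφ
    have hAf : Integrable fun x => (A : ℂ) * f x := hfm.1.const_mul _
    -- Triangle inequality for `A f = H f - (H f - A f)`, where `H` is the Hausdorff operator.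
    have h1 : ‖A‖ₑ * h n ≤ hardyNorm Φ (hausdorff φ f) +
        hardyNorm Φ (fun x => hausdorff φ f x - (A : ℂ) * f x) := by
      have h2 := hardyNorm_sub_le Φ hHf.1 (hHf.1.sub hAf)
      simp only [Pi.sub_apply, sub_sub_cancel] at h2
      rw [hardyNorm_const_mul, ← ofReal_norm, Complex.norm_real, ofReal_norm] at h2
      exact h2
    have h3 : ∫⁻ t in Ioi (0 : ℝ), ‖φ t‖ₑ *
        hardyNorm Φ (fun x => ((t⁻¹ : ℝ) : ℂ) * f (x / t) - f x) ≤
        (∫⁻ t in Ioi (0 : ℝ), G n t) * h n := by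
      rw [← lintegral_mul_const' _ _ hntop]
      refine setLIntegral_mono' measurableSet_Ioi fun t (ht : 0 < t) => ?_
      have hmul : Monotone fun x : ℝ≥0∞ => x * h n := monotone_id.mul_const' _
      rw [hG, mul_assoc, hmul.map_min, ENNReal.div_mul_cancel hn0 hntop]
      gcongr
      refine le_min ?_ (hardyNorm_logAverage_dilate_sub_le Φ integrable_haar hN ht)
      refine (hardyNorm_sub_le Φ ((hfm.1.comp_div ht.ne').const_mul _) hfm.1).trans ?_
      rw [hardyNorm_comp_div_mul_inv Φ f ht, two_mul]
    refine (ENNReal.mul_le_mul_iff_left hn0 hntop).1 ?_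
    rw [add_mul]
    exact h1.trans (add_le_add (hardyNorm_hausdorff_le_opNormH1_mul φ hfm hn0)
      ((hardyNorm_hausdorff_sub_le Φ hfm.1 hφ).trans h3))
  have hGlim : Tendsto (fun n => ∫⁻ t in Ioi (0 : ℝ), G n t) atTop (𝓝 0) := by
    have h := tendsto_lintegral_of_dominated_convergence'
      (μ := volume.restrict (Ioi (0 : ℝ))) (F := G) (f := fun _ => 0) (fun t => ‖φ t‖ₑ * 2)
      (fun n => hφ.aestronglyMeasurable.enorm.mul
        (Measurable.aemeasurable (by fun_prop)))
      (fun n => ae_of_all _ fun t => mul_le_mul_right (min_le_left _ _) _) ?_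
      (ae_of_all _ fun t => ?_)
    · simpa using h
    · rw [lintegral_mul_const' _ _ (by simp)]
      exact ENNReal.mul_ne_top hφ.2.ne (by simp)
    · have hne : ENNReal.ofReal (2 * |Real.log t|) * K ≠ ∞ :=
        ENNReal.mul_ne_top ENNReal.ofReal_ne_top hKtop
      have h1 := ENNReal.Tendsto.const_div hlim (Or.inr hne)
      rw [ENNReal.div_top] at h1
      have h2 := ENNReal.Tendsto.const_mul (a := ‖φ t‖ₑ) (tendsto_const_nhds.min h1)
        (b := min 2 0) (Or.inr enorm_ne_top)
      rw [min_eq_right zero_le_two, mul_zero] at h2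
      exact h2
  have h0 := hGlim.const_add (opNormH1 Φ (hausdorff φ))
  rw [add_zero] at h0
  refine ge_of_tendsto h0 ?_
  filter_upwards [hlim.eventually (lt_mem_nhds ENNReal.zero_lt_top)] with n hn
  exact hstep n hn.ne'

end RealHardy

theorem theorem1p1 (Φ : 𝓢(ℝ, ℂ)) (hΦ : (∫ x, Φ x) ≠ 0)
    (φ : ℝ → ℝ) (hφ : IntegrableOn φ (Ioi 0))
    (hφ_nonneg : ∀ᵐ t ∂(volume.restrict (Ioi (0 : ℝ))), 0 ≤ φ t) :
    -- the operator is well defined on `H¹(ℝ)` (also on a.e. classes) and maps it into itself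
    (∀ f : ℝ → ℂ, RealHardy.MemH1 Φ f →
      (∀ᵐ x : ℝ, IntegrableOn (fun t : ℝ => f (x / t) * ((φ t / t : ℝ) : ℂ)) (Ioi 0)) ∧
      RealHardy.MemH1 Φ (RealHardy.hausdorff φ f)) ∧
    (∀ f g : ℝ → ℂ, RealHardy.MemH1 Φ f → f =ᵐ[volume] g →
      RealHardy.hausdorff φ f =ᵐ[volume] RealHardy.hausdorff φ g) ∧
    -- its operator norm
    RealHardy.opNormH1 Φ (RealHardy.hausdorff φ) = ENNReal.ofReal (∫ t in Ioi (0 : ℝ), φ t) := by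
  refine ⟨fun f hf => ⟨RealHardy.ae_integrableOn_hausdorff hf.1 hφ, hf.hausdorff hφ⟩,
    fun f g _ hfg => RealHardy.hausdorff_congr_ae φ hfg, ?_⟩
  have h : ∫⁻ t in Ioi (0 : ℝ), ‖φ t‖ₑ = ENNReal.ofReal (∫ t in Ioi (0 : ℝ), φ t) := by
    rw [ofReal_integral_eq_lintegral_ofReal hφ hφ_nonneg]
    refine lintegral_congr_ae ?_
    filter_upwards [hφ_nonneg] with t ht
    exact Real.enorm_of_nonneg ht
  refine le_antisymm ((RealHardy.opNormH1_hausdorff_le Φ hφ).trans_eq h) ?_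
  rw [← Real.enorm_of_nonneg (integral_nonneg_of_ae hφ_nonneg)]
  exact RealHardy.enorm_integral_le_opNormH1_hausdorff hΦ hφ
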